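/- Let $n\geq 2$ and $A\in \mathrm{GL}_n(\mathbb{R})$. The action of $A$ on the space of rays $\{tv : t>0\}$, $v\in\mathbb{R}^n\setminus\{0\}$, through the origin of $\mathbb{R}^n$ induces, when this space is identified with the unit sphere $S^{n-1}\subset\mathbb{R}^n$ by sending each ray to the unit vector on it, the diffeomorphism $\psi_A\colon S^{n-1}\to S^{n-1}$, $\psi_A(x)=Ax/\|Ax\|$. Then the topological entropy of $\psi_A$ is zero: $h_{\mathrm{top}}(\psi_A)=0$. -/

import Mathlib

open Module Metric Set
open scoped Manifold ContDiff

noncomputable section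

section Rays

variable {E : Type*} [NormedAddCommGroup E] [InnerProductSpace ℝ E]

/-- The unit sphere is identified with the space of rays through the origin: a unit vector is sent
to the ray which it spans, and a ray to the unique unit vector on it. -/
def sphereEquivRay (E : Type*) [NormedAddCommGroup E] [InnerProductSpace ℝ E] :
    sphere (0 : E) 1 ≃ Module.Ray ℝ E where
  toFun x := rayOfNeZero ℝ (x : E) (ne_zero_of_mem_unit_sphere x)
  invFun := Quotient.lift
    (fun v : RayVector ℝ E ↦
      (⟨‖(v : E)‖⁻¹ • (v : E), by
        have hv : ‖(v : E)‖ ≠ 0 := norm_ne_zero_iff.2 v.2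
        rw [mem_sphere_zero_iff_norm, norm_smul, norm_inv, norm_norm, inv_mul_cancel₀ hv]⟩ :
        sphere (0 : E) 1))
    (fun v w h ↦ Subtype.ext ((sameRay_iff_inv_norm_smul_eq_of_ne v.2 w.2).1 h))
  left_inv x := by
    apply Subtype.ext
    change ‖(x : E)‖⁻¹ • (x : E) = x
    rw [norm_eq_of_mem_sphere, inv_one, one_smul]
  right_inv r := by
    induction r using Module.Ray.ind with
    | h v hv =>
      refine (ray_eq_iff _ hv).2 ?_
      change SameRay ℝ (‖v‖⁻¹ • v) v
      exact SameRay.sameRay_pos_smul_left v (inv_pos.2 (norm_pos_iff.2 hv))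

/-- The permutation of the unit sphere which corresponds to the action of the linear automorphism
`A` on the space of rays through the origin. -/
def rayActionEquiv (A : E ≃ₗ[ℝ] E) : sphere (0 : E) 1 ≃ sphere (0 : E) 1 :=
  (sphereEquivRay E).trans ((Module.Ray.map A).trans (sphereEquivRay E).symm)

theorem coe_rayActionEquiv (A : E ≃ₗ[ℝ] E) (x : sphere (0 : E) 1) :
    (rayActionEquiv A x : E) = ‖A x‖⁻¹ • A x := rfl

theorem rayActionEquiv_symm (A : E ≃ₗ[ℝ] E) :
    (rayActionEquiv A).symm = rayActionEquiv A.symm := by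
  ext1 x
  simp [rayActionEquiv]

theorem contMDiff_rayActionEquiv {m : ℕ} [Fact (finrank ℝ E = m + 1)] (A : E ≃ₗ[ℝ] E) :
    ContMDiff (𝓡 m) (𝓡 m) ∞ (rayActionEquiv A) := by
  have : FiniteDimensional ℝ E := .of_fact_finrank_eq_succ m
  have hA : ContDiff ℝ ∞ (fun x : E ↦ A x) := A.toContinuousLinearEquiv.contDiff
  have h : ContMDiff (𝓡 m) 𝓘(ℝ, E) ∞ (fun x : sphere (0 : E) 1 ↦ ‖A x‖⁻¹ • A (x : E)) := by
    intro x
    have hx : A (x : E) ≠ 0 := (map_ne_zero_iff A A.injective).2 (ne_zero_of_mem_unit_sphere x)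
    have h1 : ContDiffAt ℝ ∞ (fun y : E ↦ ‖A y‖⁻¹ • A y) (x : E) :=
      ((hA.contDiffAt.norm ℝ hx).inv (norm_ne_zero_iff.2 hx)).smul hA.contDiffAt
    exact h1.contMDiffAt.comp x (contMDiff_coe_sphere x)
  exact h.codRestrict_sphere fun x ↦ (rayActionEquiv A x).2

/-- The diffeomorphism of the unit sphere induced by the action of the linear automorphism `A`
on the space of rays through the origin. -/
def rayActionDiffeo (m : ℕ) [Fact (finrank ℝ E = m + 1)] (A : E ≃ₗ[ℝ] E) :
    Diffeomorph (𝓡 m) (𝓡 m) (sphere (0 : E) 1) (sphere (0 : E) 1) ∞ where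
  toEquiv := rayActionEquiv A
  contMDiff_toFun := contMDiff_rayActionEquiv A
  contMDiff_invFun := by
    rw [rayActionEquiv_symm]
    exact contMDiff_rayActionEquiv A.symm

end Rays

/-- An invertible real matrix as a linear automorphism of Euclidean space. -/
def glEuclidean {n : ℕ} (A : GL (Fin n) ℝ) :
    EuclideanSpace ℝ (Fin n) ≃ₗ[ℝ] EuclideanSpace ℝ (Fin n) where
  toLinearMap := Matrix.toEuclideanLin (A : Matrix (Fin n) (Fin n) ℝ)
  invFun := Matrix.toEuclideanLin ((A⁻¹ : GL (Fin n) ℝ) : Matrix (Fin n) (Fin n) ℝ)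
  left_inv x := by
    simp [Matrix.toLpLin_apply, Matrix.mulVec_mulVec, ← Units.val_mul, -Matrix.coe_units_inv]
  right_inv x := by
    simp [Matrix.toLpLin_apply, Matrix.mulVec_mulVec, ← Units.val_mul, -Matrix.coe_units_inv]

/-- This makes the unit sphere of `ℝⁿ` a smooth manifold of dimension `n - 1`, for `n ≠ 0`. -/
instance fact_finrank_euclideanSpace {n : ℕ} [NeZero n] :
    Fact (finrank ℝ (EuclideanSpace ℝ (Fin n)) = (n - 1) + 1) :=
  ⟨by rw [finrank_euclideanSpace_fin, Nat.sub_add_cancel NeZero.one_le]⟩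

/-- For `A ∈ GL_n(ℝ)`, the diffeomorphism of the sphere `S^{n-1}` induced by the action
of `A` on the space of rays through the origin of `ℝⁿ`. -/
def rayDiffeo {n : ℕ} [NeZero n] (A : GL (Fin n) ℝ) :
    Diffeomorph (𝓡 (n - 1)) (𝓡 (n - 1)) (sphere (0 : EuclideanSpace ℝ (Fin n)) 1)
      (sphere (0 : EuclideanSpace ℝ (Fin n)) 1) ∞ :=
  rayActionDiffeo (n - 1) (glEuclidean A)

theorem coe_rayDiffeo {n : ℕ} [NeZero n] (A : GL (Fin n) ℝ)
    (x : sphere (0 : EuclideanSpace ℝ (Fin n)) 1) :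
    (rayDiffeo A x : EuclideanSpace ℝ (Fin n)) =
      ‖Matrix.toEuclideanLin (A : Matrix (Fin n) (Fin n) ℝ) x‖⁻¹ •
        Matrix.toEuclideanLin (A : Matrix (Fin n) (Fin n) ℝ) x := rfl

end

/-!
The sphere is cut into small cells by finitely many hyperplanes through the origin: two distinct
unit vectors `x`, `y` are strictly separated by the hyperplane orthogonal to `x - y`, so by
compactness finitely many hyperplanes separate all pairs of unit vectors which are not close to each
other (`exists_finset_inner_pos_separating`). Since the `k`-th iterate of the ray action of `A`
sends `x` to a positive multiple of `A ^ k x`, the sign of a linear functional along an orbit is the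
sign of another *linear* functional at the initial point. Hence orbits of length `N` whose initial
points have the same signs on `N * c` fixed linear functionals shadow each other.

The family of sign patterns which are realized by linear functionals on a space of dimension `d` has
Vapnik-Chervonenkis dimension at most `d`, as shattered functionals are linearly independent
(`linearIndependent_of_shatters_signPatterns`), so the Sauer-Shelah lemma bounds the number of sign
patterns by `(N * c + 1) ^ d` (`card_signPatterns_le`). This is polynomial in `N`, so the entropy
vanishes (`coverEntropyEntourage_nonpos_of_coverMincard_le`).
-/

open Filter Topology Uniformity
open scoped RealInnerProductSpace ENNReal

/-! ### Sign patterns of linear functionals -/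

theorem Nat.sum_Iic_choose_le_succ_pow (m d : ℕ) :
    ∑ k ∈ Finset.Iic d, m.choose k ≤ (m + 1) ^ d := by
  have hIic : Finset.Iic d = Finset.range (d + 1) := by
    ext k
    simp
  rw [add_pow, hIic]
  refine Finset.sum_le_sum fun k hk ↦ (Nat.choose_le_pow m k).trans ?_
  rw [one_pow, mul_one]
  exact Nat.le_mul_of_pos_right _ (Nat.choose_pos (Nat.lt_succ_iff.1 (Finset.mem_range.1 hk)))

section SignPatterns

variable {ι V : Type*} [Fintype ι] [AddCommGroup V] [Module ℝ V]

open Classical in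
/-- The set of indices of the functionals in the family `f` which are positive at `x`. -/
noncomputable def posIndices (f : ι → Dual ℝ V) (x : V) : Finset ι :=
  {i | 0 < f i x}

theorem mem_posIndices {f : ι → Dual ℝ V} {x : V} {i : ι} :
    i ∈ posIndices f x ↔ 0 < f i x := by
  simp [posIndices]

open Classical in
/-- The patterns of positivity of the functionals in the family `f` which are realized at some
vector. The zero set of a functional is not distinguished from its negative side. -/
noncomputable def signPatterns (f : ι → Dual ℝ V) : Finset (Finset ι) :=
  {s | s ∈ Set.range (posIndices f)}

theorem mem_signPatterns {f : ι → Dual ℝ V} {s : Finset ι} :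
    s ∈ signPatterns f ↔ ∃ x, posIndices f x = s := by
  simp [signPatterns]

variable [DecidableEq ι]

/-- Otherwise some vector `x` would have `f i x > 0` exactly where the coefficient of `f i` in
a given linear relation is positive, and the relation, evaluated at `x`, would be a vanishing sum of
nonnegative terms, not all zero. -/
theorem linearIndependent_of_shatters_signPatterns {f : ι → Dual ℝ V} {s : Finset ι}
    (hs : (signPatterns f).Shatters s) : LinearIndependent ℝ (fun i : s ↦ f i) := by
  have key (g : s → ℝ) (hg : ∑ i, g i • f i = 0) (i : s) : g i ≤ 0 := by
    by_contra! hi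
    obtain ⟨u, hu, hsu⟩ := hs (t := {j ∈ s.attach | 0 < g j}.map (.subtype (· ∈ s)))
      (by intro j; simp +contextual)
    obtain ⟨x, rfl⟩ := mem_signPatterns.1 hu
    have hx (j : s) : 0 < f j x ↔ 0 < g j := by
      have := congrArg ((j : ι) ∈ ·) hsu
      simpa [mem_posIndices] using this
    have hnonneg (j : s) : 0 ≤ g j * f j x := by
      by_cases hj : 0 < g j
      · exact (mul_pos hj ((hx j).2 hj)).le
      · exact mul_nonneg_of_nonpos_of_nonpos (not_lt.1 hj) (not_lt.1 (mt (hx j).1 hj))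
    have hsum : ∑ j, g j * f j x = 0 := by
      simpa using congrArg (fun φ : Dual ℝ V ↦ φ x) hg
    have := (Finset.sum_eq_zero_iff_of_nonneg fun j _ ↦ hnonneg j).1 hsum i (Finset.mem_univ i)
    exact (mul_pos hi ((hx i).2 hi)).ne' this
  refine Fintype.linearIndependent_iff.2 fun g hg i ↦ (key g hg i).antisymm ?_
  have hneg : ∑ j, (-g) j • f j = 0 := by
    rw [← neg_zero, ← hg, ← Finset.sum_neg_distrib]
    exact Finset.sum_congr rfl fun j _ ↦ neg_smul (g j) (f j)
  have := key (-g) hneg i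
  simpa using this

theorem card_signPatterns_le [FiniteDimensional ℝ V] (f : ι → Dual ℝ V) :
    (signPatterns f).card ≤ (Fintype.card ι + 1) ^ finrank ℝ V := by
  have hdim : (signPatterns f).vcDim ≤ finrank ℝ V := by
    refine Finset.sup_le fun s hs ↦ ?_
    have := (linearIndependent_of_shatters_signPatterns
      (Finset.mem_shatterer.1 hs)).fintype_card_le_finrank
    rwa [Fintype.card_coe, Subspace.dual_finrank_eq] at this
  calc (signPatterns f).card
      ≤ (signPatterns f).shatterer.card := Finset.card_le_card_shatterer _
    _ ≤ ∑ k ∈ Finset.Iic (signPatterns f).vcDim, (Fintype.card ι).choose k :=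
        Finset.card_shatterer_le_sum_vcDim
    _ ≤ (Fintype.card ι + 1) ^ (signPatterns f).vcDim := Nat.sum_Iic_choose_le_succ_pow _ _
    _ ≤ (Fintype.card ι + 1) ^ finrank ℝ V := Nat.pow_le_pow_right (Nat.succ_pos _) hdim

end SignPatterns

/-! ### Covers of polynomial cardinality -/

theorem expGrowthSup_pow_const_nonpos (d : ℕ) :
    ExpGrowth.expGrowthSup (fun N : ℕ ↦ (N : ℝ≥0∞) ^ d) ≤ 0 := by
  refine ExpGrowth.expGrowthSup_le_iff.2 fun b hb ↦ ?_
  obtain ⟨r, hr, hrb⟩ := EReal.lt_iff_exists_real_btwn.1 hb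
  have hr0 : 0 < r := by exact_mod_cast hr
  have hlim := ((isLittleO_pow_exp_pos_mul_atTop d hr0).bound one_pos).natCast_atTop
  filter_upwards [hlim] with N hN
  have hN' : (N : ℝ) ^ d ≤ Real.exp (r * N) := by
    simpa using hN
  calc (N : ℝ≥0∞) ^ d = ENNReal.ofReal ((N : ℝ) ^ d) := by
        rw [ENNReal.ofReal_pow (Nat.cast_nonneg N), ENNReal.ofReal_natCast]
    _ ≤ ENNReal.ofReal (Real.exp (r * N)) := ENNReal.ofReal_le_ofReal hN'
    _ = EReal.exp ((r * N : ℝ) : EReal) := (EReal.exp_coe _).symm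
    _ ≤ EReal.exp (b * N) := by
        refine EReal.exp_le_exp_iff.2 ?_
        rw [EReal.coe_mul, EReal.coe_natCast]
        exact mul_le_mul_of_nonneg_right hrb.le (Nat.cast_nonneg' N)

theorem coverEntropyEntourage_nonpos_of_coverMincard_le {X : Type*} {T : X → X} {F : Set X}
    {U : SetRel X X} {c d : ℕ}
    (h : ∀ N, Dynamics.coverMincard T F U N ≤ ((N * c + 1) ^ d : ℕ)) :
    Dynamics.coverEntropyEntourage T F U ≤ 0 := by
  refine le_trans ?_ (expGrowthSup_pow_const_nonpos d)
  refine ExpGrowth.expGrowthSup_le_of_eventually_le (b := (((c + 1) ^ d : ℕ) : ℝ≥0∞))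
    (ENNReal.natCast_ne_top _) ?_
  filter_upwards [eventually_ge_atTop 1] with N hN
  have hle : (N * c + 1) ^ d ≤ (c + 1) ^ d * N ^ d := by
    rw [← mul_pow]
    exact Nat.pow_le_pow_left (by nlinarith) d
  calc ((Dynamics.coverMincard T F U N : ℕ∞) : ℝ≥0∞)
      ≤ ((((N * c + 1) ^ d : ℕ) : ℕ∞) : ℝ≥0∞) := ENat.toENNReal_mono (h N)
    _ = (((N * c + 1) ^ d : ℕ) : ℝ≥0∞) := by simp
    _ ≤ (((c + 1) ^ d * N ^ d : ℕ) : ℝ≥0∞) := Nat.cast_le.2 hle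
    _ = (((c + 1) ^ d : ℕ) : ℝ≥0∞) * (N : ℝ≥0∞) ^ d := by push_cast; rfl

/-! ### Entropy of the action on rays -/

section RayAction

variable {E : Type*} [NormedAddCommGroup E] [InnerProductSpace ℝ E]

theorem exists_pos_coe_rayActionEquiv_iterate_eq_smul (A : E ≃ₗ[ℝ] E) (k : ℕ)
    (x : sphere (0 : E) 1) :
    ∃ r : ℝ, 0 < r ∧ ((rayActionEquiv A)^[k] x : E) = r • A^[k] (x : E) := by
  induction k with
  | zero => exact ⟨1, one_pos, by simp⟩
  | succ k ih =>
    obtain ⟨r, hr, h⟩ := ih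
    rw [Function.iterate_succ_apply', Function.iterate_succ_apply', coe_rayActionEquiv]
    set y := (rayActionEquiv A)^[k] x
    have hy : 0 < ‖A (y : E)‖ := norm_pos_iff.2
      ((map_ne_zero_iff A A.injective).2 (ne_zero_of_mem_unit_sphere y))
    refine ⟨‖A (y : E)‖⁻¹ * r, mul_pos (inv_pos.2 hy) hr, ?_⟩
    rw [mul_smul, ← A.map_smul r, ← h]

variable [FiniteDimensional ℝ E]

/-- Unit vectors on the positive sides of the same members of a suitable finite family of hyperplanes
are `U`-close. -/
theorem exists_finset_inner_pos_separating {U : SetRel (sphere (0 : E) 1) (sphere (0 : E) 1)}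
    (hU : U ∈ 𝓤 (sphere (0 : E) 1)) :
    ∃ L : Finset E, ∀ x y : sphere (0 : E) 1,
      (∀ u ∈ L, 0 < ⟪u, (x : E)⟫ ↔ 0 < ⟪u, (y : E)⟫) → (x, y) ∈ U := by
  have hK : IsCompact (interior U)ᶜ := isOpen_interior.isClosed_compl.isCompact
  let V (u : E) : Set (sphere (0 : E) 1 × sphere (0 : E) 1) :=
    {p | 0 < ⟪u, (p.1 : E)⟫ ∧ ⟪u, (p.2 : E)⟫ < 0}
  have hV (u : E) : IsOpen (V u) :=
    .and (isOpen_lt continuous_const (by fun_prop)) (isOpen_lt (by fun_prop) continuous_const)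
  have hKV : (interior U)ᶜ ⊆ ⋃ u, V u := by
    rintro ⟨x, y⟩ hp
    have hne : (x : E) ≠ y := by
      intro h
      obtain rfl : x = y := Subtype.ext h
      exact hp (refl_mem_uniformity (interior_mem_uniformity hU))
    have hlt : ⟪(x : E), (y : E)⟫ < 1 :=
      (inner_lt_one_iff_real_of_norm_eq_one (by simp) (by simp)).2 hne
    have hxx : ⟪(x : E), (x : E)⟫ = 1 := by simp
    have hyy : ⟪(y : E), (y : E)⟫ = 1 := by simp
    refine Set.mem_iUnion.2 ⟨(x : E) - y, ?_, ?_⟩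
    · rw [inner_sub_left, hxx, real_inner_comm]
      linarith
    · rw [inner_sub_left, hyy]
      linarith
  obtain ⟨L, hL⟩ := hK.elim_finite_subcover V hV hKV
  refine ⟨L, fun x y hxy ↦ ?_⟩
  by_contra hUxy
  obtain ⟨u, hu, hx, hy⟩ := Set.mem_iUnion₂.1
    (hL (fun h ↦ hUxy (interior_subset h) : (x, y) ∈ (interior U)ᶜ))
  exact hy.not_gt ((hxy u hu).1 hx)

/-- Orbits of length `N` shadow each other as soon as their initial points lie in the same cell of
the arrangement formed by the preimages under `A ^ k`, `k < N`, of the hyperplanes given by `L`. -/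
theorem coverMincard_rayActionEquiv_le (A : E ≃ₗ[ℝ] E)
    {U : SetRel (sphere (0 : E) 1) (sphere (0 : E) 1)} {L : Finset E}
    (hL : ∀ x y : sphere (0 : E) 1,
      (∀ u ∈ L, 0 < ⟪u, (x : E)⟫ ↔ 0 < ⟪u, (y : E)⟫) → (x, y) ∈ U) (N : ℕ) :
    Dynamics.coverMincard (rayActionEquiv A) Set.univ U N
      ≤ ((N * L.card + 1) ^ finrank ℝ E : ℕ) := by
  classical
  let f : Fin N × L → Dual ℝ E := fun i ↦
    (innerₗ E (i.2 : E)).comp ((A : E →ₗ[ℝ] E) ^ (i.1 : ℕ))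
  have hf (i : Fin N × L) (x : sphere (0 : E) 1) :
      0 < ⟪(i.2 : E), ((rayActionEquiv A)^[i.1] x : E)⟫ ↔ 0 < f i x := by
    obtain ⟨r, hr, h⟩ := exists_pos_coe_rayActionEquiv_iterate_eq_smul A i.1 x
    have hfi : f i x = ⟪(i.2 : E), A^[i.1] (x : E)⟫ := by
      simp [f, Module.End.pow_apply]
    rw [h, inner_smul_right, hfi, mul_pos_iff_of_pos_left hr]
  -- One point of the sphere is chosen for each pattern which is realized on the sphere.
  let p : sphere (0 : E) 1 → Finset (Fin N × L) := fun x ↦ posIndices f x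
  have hfin : (Set.range p).Finite := Set.toFinite _
  choose g hg using fun s : Set.range p ↦ s.2
  have : Fintype (Set.range p) := hfin.fintype
  have hcover : Dynamics.IsDynCoverOf (rayActionEquiv A) Set.univ U N
      (Finset.univ.image g : Finset (sphere (0 : E) 1)) := by
    intro x _
    refine ⟨g ⟨p x, x, rfl⟩, by simp, Dynamics.mem_dynEntourage.2 fun k hk ↦ hL _ _ fun u hu ↦ ?_⟩
    have hp : p (g ⟨p x, x, rfl⟩) = p x := hg ⟨p x, x, rfl⟩
    rw [hf (⟨k, hk⟩, ⟨u, hu⟩) x, hf (⟨k, hk⟩, ⟨u, hu⟩) (g _), ← mem_posIndices, ← mem_posIndices]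
    exact iff_of_eq (congrArg ((⟨k, hk⟩, ⟨u, hu⟩) ∈ ·) hp.symm)
  refine hcover.coverMincard_le_card.trans (Nat.cast_le.2 ?_)
  calc (Finset.univ.image g).card
      ≤ Fintype.card (Set.range p) := Finset.card_image_le
    _ = (Set.range p).toFinset.card := (Set.toFinset_card _).symm
    _ ≤ (signPatterns f).card := Finset.card_le_card fun s hs ↦ by
        obtain ⟨x, rfl⟩ := Set.mem_toFinset.1 hs
        exact mem_signPatterns.2 ⟨x, rfl⟩
    _ ≤ (Fintype.card (Fin N × L) + 1) ^ finrank ℝ E := card_signPatterns_le f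
    _ = (N * L.card + 1) ^ finrank ℝ E := by simp

theorem coverEntropy_rayActionEquiv_nonpos (A : E ≃ₗ[ℝ] E) :
    Dynamics.coverEntropy (rayActionEquiv A) Set.univ ≤ 0 := by
  refine iSup₂_le fun U hU ↦ ?_
  obtain ⟨L, hL⟩ := exists_finset_inner_pos_separating hU
  exact coverEntropyEntourage_nonpos_of_coverMincard_le (coverMincard_rayActionEquiv_le A hL)

end RayAction

theorem proposition3p5 (n : ℕ) [NeZero n] (hn : 2 ≤ n) (A : GL (Fin n) ℝ) :
    Dynamics.coverEntropy (rayDiffeo A)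
      (Set.univ : Set (Metric.sphere (0 : EuclideanSpace ℝ (Fin n)) 1)) = 0 := by
  refine (coverEntropy_rayActionEquiv_nonpos (glEuclidean A)).antisymm
    (Dynamics.coverEntropy_nonneg _ ?_)
  exact ⟨⟨EuclideanSpace.single 0 1, by simp⟩, Set.mem_univ _⟩
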